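/- **Setting.** Let $n\ge 0$, let $\mathcal X$ be a measurable space, let $\mathcal Y\subset\mathbb R$ be nonempty and compact, and let $L\ge 0$. Let $\ell:\mathbb R\times\mathbb R\to\mathbb R$ be a loss such that for every $y\in\mathcal Y$ the function $\ell(\cdot,y)$ is convex, is $L$-Lipschitz on $\mathcal Y$, and has at each point of $\mathcal Y$ a subderivative in $[-L,L]$. Assume that for every Borel probability measure $p$ on $\mathcal Y$ (for which $\ell(u,\cdot)$ is $p$-integrable for all $u\in\mathbb R$) the function $u\mapsto \mathbb E_{y\sim p}\,\ell(u,y)$ on $\mathbb R$ has a minimizer lying in $\mathcal Y$. Let $\phi:(\mathcal X\times\mathcal Y)^n\to\mathbb R$ be bounded. A *(randomized) prediction strategy* consists of maps $q_t$, $t=1,\dots,n$, assigning to $(x_1,\dots,x_t,y_1,\dots,y_{t-1})$ a Borel probability measure on $\mathcal Y$. It *achieves* $\phi$ if for every sequence $(x_1,y_1),\dots,(x_n,y_n)$ in $\mathcal X\times\mathcal Y$, with independent draws $\hat y_t\sim q_t(x_{1:t},y_{1:t-1})$, $$\mathbb E\Big[\sum_{t=1}^n \ell(\hat y_t,y_t)\Big]\le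 \phi(x_1,y_1,\dots,x_n,y_n).$$ Let $\mathcal T$ be a real vector space, $\mathbf T:(\mathcal X\times\mathcal Y)\times[-L,L]\to\mathcal T$ and $V:\mathcal T\to\mathbb R$. Call $(\mathbf T,V)$ a *sufficient statistic pair* for $\phi$ if $$\sum_{t=1}^n \ell(\hat y_t,y_t)-\phi(x_1,y_1,\dots,x_n,y_n)\le V\Big(\sum_{t=1}^n \mathbf T\big((x_t,\hat y_t),\delta_t\big)\Big)$$ for all $x_t\in\mathcal X$, all $\hat y_t,y_t\in\mathcal Y$ and all subderivatives $\delta_t\in[-L,L]$ of $\ell(\cdot,y_t)$ at $\hat y_t$. **Lemma.** Suppose $(\mathbf T,V)$ is a sufficient statistic pair for $\phi$. 1. Suppose that $$\mathbb E\Big[V\Big(\sum_{t=1}^n \mathbf T\big(\boldsymbol z_t(\delta_1,\dots,\delta_{t-1}),\delta_t\big)\Big)\Big]\le 0$$ for every sequence of measurable functions $\boldsymbol z_t:[-L,L]^{t-1}\to\mathcal X\times\mathcal Y$ and every law of a $[-L,L]$-valued martingale difference sequence $\delta=(\delta_1,\dots,\delta_n)$ (that is, $\mathbb E[\delta_t\mid\sigma(\delta_1,\dots,\delta_{t-1})]=0$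 for all $t$) for which the random variable inside the expectation is integrable. Then there is a prediction strategy that achieves $\phi$. 2. Suppose that for all $z\in\mathcal X\times\mathcal Y$ and $\tau\in\mathcal T$ the function $\alpha\mapsto V(\tau+\mathbf T(z,\alpha))$ is convex on $[-L,L]$. Then, for the existence of a prediction strategy that achieves $\phi$, it is enough that the inequality of part 1 holds for every $\boldsymbol z$ when $\delta_t=\epsilon_t L$, $t=1,\dots,n$, with independent Rademacher random variables $\epsilon_1,\dots,\epsilon_n$. -/

import Mathlib

open MeasureTheory Set
open scoped NNReal ENNReal

noncomputable section

/-- `g` is a subderivative of `f : ℝ → ℝ` at the point `a`. -/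
def IsSubderivative (f : ℝ → ℝ) (a g : ℝ) : Prop :=
  ∀ u : ℝ, f a + g * (u - a) ≤ f u

/-- Standing assumptions on the loss `ℓ (prediction) (outcome)` over the set `Y` of
predictions and outcomes. -/
structure IsAdmissibleLoss (Y : Set ℝ) (L : ℝ≥0) (ℓ : ℝ → ℝ → ℝ) : Prop where
  /-- `ℓ` is convex in its first argument. -/
  convex : ∀ y ∈ Y, ConvexOn ℝ univ (fun a => ℓ a y)
  /-- `ℓ` is `L`-Lipschitz in its first argument over `Y`. -/
  lipschitz : ∀ y ∈ Y, LipschitzOnWith L (fun a => ℓ a y) Y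
  /-- At points of `Y` there is a subderivative in `[-L, L]`. (This follows from the other three
  conditions when `Y` is an interval.) -/
  exists_subderivative : ∀ a ∈ Y, ∀ y ∈ Y,
    ∃ g ∈ Icc (-(L : ℝ)) L, IsSubderivative (fun u => ℓ u y) a g
  /-- For every distribution `p` on `Y`, the expected loss has a minimizer over `ℝ` that lies
  in `Y`. -/
  argmin_mem : ∀ p : Measure Y, IsProbabilityMeasure p →
    (∀ u : ℝ, Integrable (fun y : Y => ℓ u y) p) →
      ∃ a ∈ Y, ∀ u : ℝ, ∫ y : Y, ℓ a y ∂p ≤ ∫ y : Y, ℓ u y ∂p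

/-- `(T, V)` is an (additive) sufficient statistic pair for `φ`. The subderivative `δ t` of
`ℓ(·, y t)` at `yhat t` may be any one in `[-L, L]`. -/
def IsSufficientStatisticPair {X 𝒯 : Type*} [AddCommGroup 𝒯] {n : ℕ} {Y : Set ℝ}
    (L : ℝ≥0) (ℓ : ℝ → ℝ → ℝ) (φ : (Fin n → X × Y) → ℝ)
    (T : X × Y → ℝ → 𝒯) (V : 𝒯 → ℝ) : Prop :=
  ∀ (x : Fin n → X) (yhat y : Fin n → Y) (δ : Fin n → ℝ),
    (∀ t, δ t ∈ Icc (-(L : ℝ)) L ∧ IsSubderivative (fun u => ℓ u (y t)) (yhat t) (δ t)) →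
      ∑ t, ℓ (yhat t) (y t) - φ (fun t => (x t, y t)) ≤ V (∑ t, T (x t, yhat t) (δ t))

/-- The first `t` entries `(v 0, …, v (t - 1))` of a finite sequence: what precedes entry `t`. -/
def past {α : Type*} {n : ℕ} (t : Fin n) (v : Fin n → α) : Fin t → α :=
  fun s => v (s.castLE t.isLt.le)

/-- The first `t + 1` entries `(v 0, …, v t)` of a finite sequence. -/
def upTo {α : Type*} {n : ℕ} (t : Fin n) (v : Fin n → α) : Fin (t + 1) → α :=
  fun s => v (s.castLE t.isLt)

/-- `μ` is the joint law of a `[-L, L]`-valued martingale difference sequence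
`δ = (δ 0, …, δ (n - 1))`, with respect to its natural filtration. -/
structure IsMartingaleDifferenceLaw {n : ℕ} (L : ℝ≥0) (μ : Measure (Fin n → ℝ)) : Prop where
  isProbabilityMeasure : IsProbabilityMeasure μ
  mem_Icc : ∀ᵐ δ ∂μ, ∀ t, δ t ∈ Icc (-(L : ℝ)) L
  condExp_eq_zero : ∀ t : Fin n,
    μ[fun δ => δ t | MeasurableSpace.comap (past t) MeasurableSpace.pi] =ᵐ[μ] 0

/-- A predictable sequence: `z t` is a measurable function of what precedes time `t`. -/
structure PredictableSequence (n : ℕ) (Z : Type*) [MeasurableSpace Z] where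
  toFun : (t : Fin n) → (Fin t → ℝ) → Z
  measurable : ∀ t, Measurable (toFun t)

/-- `V (∑ₜ T (zₜ (δ₁, …, δₜ₋₁), δₜ))`. -/
def statisticValue {Z 𝒯 : Type*} [MeasurableSpace Z] [AddCommGroup 𝒯] {n : ℕ}
    (T : Z → ℝ → 𝒯) (V : 𝒯 → ℝ) (z : PredictableSequence n Z) (δ : Fin n → ℝ) : ℝ :=
  V (∑ t, T (z.toFun t (past t δ)) (δ t))

/-- The law of a Rademacher random variable. -/
def rademacher : Measure ℝ :=
  (2⁻¹ : ℝ≥0∞) • Measure.dirac 1 + (2⁻¹ : ℝ≥0∞) • Measure.dirac (-1)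

/-- A randomized prediction strategy: in round `t`, having seen `x₁, …, xₜ` and
`y₁, …, yₜ₋₁`, the forecaster draws the prediction from the distribution `q t` on `Y`, with
fresh randomness. -/
abbrev PredictionStrategy (n : ℕ) (X : Type*) (Y : Set ℝ) :=
  (t : Fin n) → (Fin (t + 1) → X) → (Fin t → Y) → ProbabilityMeasure Y

/-- The joint law of the predictions when the data sequence is `(x, y)`. -/
def PredictionStrategy.law {n : ℕ} {X : Type*} {Y : Set ℝ} (q : PredictionStrategy n X Y)
    (x : Fin n → X) (y : Fin n → Y) : Measure (Fin n → Y) :=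
  Measure.pi fun t => (q t (upTo t x) (past t y) : Measure Y)

/-- The strategy `q` guarantees `E[∑ₜ ℓ(ŷₜ, yₜ)] ≤ φ(x₁, y₁, …, xₙ, yₙ)` for all data sequences. -/
def PredictionStrategy.Achieves {n : ℕ} {X : Type*} {Y : Set ℝ} (q : PredictionStrategy n X Y)
    (ℓ : ℝ → ℝ → ℝ) (φ : (Fin n → X × Y) → ℝ) : Prop :=
  ∀ (x : Fin n → X) (y : Fin n → Y),
    ∫ yhat, ∑ t, ℓ (yhat t) (y t) ∂(q.law x y) ≤ φ (fun t => (x t, y t))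

end

open MeasureTheory Set
open scoped NNReal ENNReal

noncomputable section

/-! The randomized strategies form a product of spaces of probability measures on the compact set
`Y`, hence a compact space. The excess loss on each data sequence is continuous and affine in the
strategy. By minimax (`PredictionStrategy.exists_achieves`) it suffices to answer,
deterministically, each known mixture of finitely many data sequences, so everything below lives on
a finite probability space and integrability is automatic.

Against such a mixture, the forecaster minimizes the conditional expected loss given the history. At
the minimizer there are subderivatives in `[-L, L]` with conditional mean zero
(`IsAdmissibleLoss.exists_balanced_subderivative`). Hence `δ` is a martingale difference, and the
sufficient statistic bounds the excess loss (`exists_response_nonpos`).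

The pairs `z t = (x t, yhat t)` depend on the data, not only on the past of `δ`. Round by round, and
for each past of `δ`, one conditions on a value of `z t` for which the conditional expectation of
the statistic does not drop. Since `δ t` has mean zero given `z` up to and including time `t`, the
martingale property survives (`IsFiniteMartingaleDifference.exists_predictable`), which gives part
1.

For part 2, convexity allows each `δ t / L` to be replaced by a random sign with the same
conditional mean. A martingale difference of signs is an independent Rademacher sequence, and the
same conditioning makes `z` predictable from it. -/

/-! ### Finitely supported measures -/

/-- The measure with mass `p i` at the point `y i`. -/
def weightedDirac {ι α : Type*} [Fintype ι] [MeasurableSpace α] (p : ι → ℝ) (y : ι → α) :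
    Measure α :=
  ∑ i, ENNReal.ofReal (p i) • Measure.dirac (y i)

section weightedDirac

variable {ι α : Type*} [Fintype ι] [MeasurableSpace α] {p : ι → ℝ} (y : ι → α)

lemma isProbabilityMeasure_weightedDirac (hp : ∀ i, 0 ≤ p i) (hp1 : ∑ i, p i = 1) :
    IsProbabilityMeasure (weightedDirac p y) := by
  constructor
  simp only [weightedDirac, Measure.coe_finsetSum, Measure.coe_smul, Finset.sum_apply,
    Pi.smul_apply, measure_univ, smul_eq_mul, mul_one]
  rw [← ENNReal.ofReal_sum_of_nonneg (fun i _ => hp i), hp1, ENNReal.ofReal_one]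

lemma ae_weightedDirac [MeasurableSingletonClass α] {P : α → Prop}
    (h : ∀ i, p i ≠ 0 → P (y i)) : ∀ᵐ a ∂weightedDirac p y, P a := by
  rw [ae_iff]
  simp only [weightedDirac, Measure.coe_finsetSum, Measure.coe_smul, Finset.sum_apply,
    Pi.smul_apply, smul_eq_mul, Finset.sum_eq_zero_iff, Finset.mem_univ, true_imp_iff, mul_eq_zero]
  intro i
  by_cases hi : p i = 0
  · simp [hi]
  · right
    simp [h i hi]

lemma integrable_weightedDirac [MeasurableSingletonClass α] (f : α → ℝ) :
    Integrable f (weightedDirac p y) := by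
  unfold weightedDirac
  rw [integrable_finsetSum_measure]
  intro i _
  exact (integrable_dirac (by simp)).smul_measure ENNReal.ofReal_ne_top

lemma integral_weightedDirac [MeasurableSingletonClass α] (hp : ∀ i, 0 ≤ p i) (f : α → ℝ) :
    ∫ a, f a ∂weightedDirac p y = ∑ i, p i * f (y i) := by
  unfold weightedDirac
  rw [integral_finsetSum_measure]
  · refine Finset.sum_congr rfl fun i _ => ?_
    rw [integral_smul_measure, integral_dirac, ENNReal.toReal_ofReal (hp i), smul_eq_mul]
  · intro i _
    exact (integrable_dirac (by simp)).smul_measure ENNReal.ofReal_ne_top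

end weightedDirac

/-! ### Subderivatives with weighted sum zero -/

lemma ConvexOn.isSubderivative_of_le_of_le {f : ℝ → ℝ} {a g : ℝ} (hf : ConvexOn ℝ univ f)
    (hl : derivWithin f (Iio a) a ≤ g) (hr : g ≤ derivWithin f (Ioi a) a) :
    IsSubderivative f a g := by
  intro u
  have ha : a ∈ interior (univ : Set ℝ) := by simp
  rcases lt_trichotomy u a with h | rfl | h
  · have h1 := (hf.slope_le_leftDeriv_of_mem_interior (mem_univ u) ha h).trans hl
    rw [slope_def_field, div_le_iff₀ (by linarith)] at h1
    linarith
  · simp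
  · have h1 := hr.trans (hf.rightDeriv_le_slope_of_mem_interior ha (mem_univ u) h)
    rw [slope_def_field, le_div_iff₀ (by linarith)] at h1
    linarith

lemma IsSubderivative.le_rightDeriv {f : ℝ → ℝ} {a g : ℝ} (h : IsSubderivative f a g)
    (hf : ConvexOn ℝ univ f) : g ≤ derivWithin f (Ioi a) a := by
  rw [hf.rightDeriv_eq_sInf_slope_of_mem_interior (by simp)]
  refine le_csInf ⟨_, a + 1, by simp, rfl⟩ ?_
  rintro _ ⟨u, ⟨-, hu⟩, rfl⟩
  rw [slope_def_field, le_div_iff₀ (by linarith)]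
  linarith [h u]

lemma IsSubderivative.leftDeriv_le {f : ℝ → ℝ} {a g : ℝ} (h : IsSubderivative f a g)
    (hf : ConvexOn ℝ univ f) : derivWithin f (Iio a) a ≤ g := by
  rw [hf.leftDeriv_eq_sSup_slope_of_mem_interior (by simp)]
  refine csSup_le ⟨_, a - 1, by simp, rfl⟩ ?_
  rintro _ ⟨u, ⟨-, hu⟩, rfl⟩
  rw [slope_comm, slope_def_field, div_le_iff₀ (by linarith)]
  linarith [h u]

lemma IsSubderivative.comp_neg {f : ℝ → ℝ} {a g : ℝ} (h : IsSubderivative f a g) :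
    IsSubderivative (fun u => f (-u)) (-a) (-g) := by
  intro u
  have := h (-u)
  simp only [neg_neg]
  linarith

lemma IsSubderivative.convexComb {f : ℝ → ℝ} {a g g' s t : ℝ} (h : IsSubderivative f a g)
    (h' : IsSubderivative f a g') (hs : 0 ≤ s) (ht : 0 ≤ t) (hst : s + t = 1) :
    IsSubderivative f a (s * g + t * g') := by
  intro u
  have h1 := mul_le_mul_of_nonneg_left (h u) hs
  have h2 := mul_le_mul_of_nonneg_left (h' u) ht
  have e : ∀ c : ℝ, c = s * c + t * c := fun c => by rw [← add_mul, hst, one_mul]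
  rw [e (f u), e (f a)]
  linarith

/-- The weighted sum of the right derivatives at a minimizer of the weighted sum is nonnegative,
also after truncation at `L`. -/
lemma exists_subderivative_sum_nonneg {ι J : Type*} [Fintype ι] {L : ℝ} {f : J → ℝ → ℝ}
    (hf : ∀ j, ConvexOn ℝ univ (f j)) {p : ι → ℝ} (hp : ∀ i, 0 ≤ p i) (y : ι → J) {a : ℝ}
    (hmin : ∀ u, ∑ i, p i * f (y i) a ≤ ∑ i, p i * f (y i) u)
    (hsub : ∀ j, ∃ g ∈ Icc (-L) L, IsSubderivative (f j) a g)
    (hright : (∃ w, a < w ∧ ∀ j, f j w - f j a ≤ L * (w - a)) ∨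
      ∀ j, ∃ m ≤ a, ∀ u, f j m ≤ f j u) :
    ∃ δ : J → ℝ, (∀ j, δ j ∈ Icc (-L) L ∧ IsSubderivative (f j) a (δ j)) ∧
      0 ≤ ∑ i, p i * δ (y i) := by
  have ha : a ∈ interior (univ : Set ℝ) := by simp
  -- The largest subderivative in `[-L, L]`. With `w` available the truncation is void, and the
  -- right derivative of the weighted sum at its minimizer is nonnegative. Otherwise `a` lies to the
  -- right of a minimizer of every `f j`, and each term is nonnegative.
  refine ⟨fun j => min (derivWithin (f j) (Ioi a) a) L, fun j => ?_, ?_⟩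
  · obtain ⟨g, hg, hgs⟩ := hsub j
    have h1 := hgs.le_rightDeriv (hf j)
    have h2 := hgs.leftDeriv_le (hf j)
    exact ⟨⟨hg.1.trans (le_min h1 hg.2), min_le_right _ _⟩,
      (hf j).isSubderivative_of_le_of_le (h2.trans (le_min h1 hg.2)) (min_le_left _ _)⟩
  · rcases hright with ⟨w, haw, hw⟩ | hm
    · have hle : ∀ j, min (derivWithin (f j) (Ioi a) a) L = derivWithin (f j) (Ioi a) a := by
        intro j
        refine min_eq_left (((hf j).rightDeriv_le_slope_of_mem_interior ha (mem_univ w) haw).trans ?_)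
        rw [slope_def_field, div_le_iff₀ (by linarith)]
        exact hw j
      simp only [hle]
      have hd : HasDerivWithinAt (fun u => ∑ i, p i * f (y i) u)
          (∑ i, p i * derivWithin (f (y i)) (Ioi a) a) (Ioi a) a :=
        HasDerivWithinAt.fun_sum fun i _ =>
          ((hf (y i)).hasDerivWithinAt_rightDeriv_of_mem_interior ha).const_mul _
      rw [hasDerivWithinAt_iff_tendsto_slope' (by simp)] at hd
      refine ge_of_tendsto hd ?_
      filter_upwards [self_mem_nhdsWithin] with u hu
      rw [slope_def_field]
      exact div_nonneg (by linarith [hmin u]) (by linarith [mem_Ioi.1 hu])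
    · refine Finset.sum_nonneg fun i _ => mul_nonneg (hp i) (le_min ?_ ?_)
      · obtain ⟨m, hma, hmu⟩ := hm (y i)
        rcases hma.lt_or_eq with hlt | rfl
        · have h1 := (hf (y i)).slope_le_leftDeriv_of_mem_interior (mem_univ m) ha hlt
          have h2 := (hf (y i)).leftDeriv_le_rightDeriv_of_mem_interior ha
          refine le_trans ?_ (h1.trans h2)
          rw [slope_def_field]
          exact div_nonneg (by linarith [hmu a]) (by linarith)
        · have : IsSubderivative (f (y i)) m 0 := fun u => by simpa using hmu u
          exact this.le_rightDeriv (hf _)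
      · obtain ⟨g, hg, -⟩ := hsub (y i)
        linarith [hg.1, hg.2]

/-- Reflection `u ↦ -u` of `exists_subderivative_sum_nonneg`; subderivatives change sign. -/
lemma exists_subderivative_sum_nonpos {ι J : Type*} [Fintype ι] {L : ℝ} {f : J → ℝ → ℝ}
    (hf : ∀ j, ConvexOn ℝ univ (f j)) {p : ι → ℝ} (hp : ∀ i, 0 ≤ p i) (y : ι → J) {a : ℝ}
    (hmin : ∀ u, ∑ i, p i * f (y i) a ≤ ∑ i, p i * f (y i) u)
    (hsub : ∀ j, ∃ g ∈ Icc (-L) L, IsSubderivative (f j) a g)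
    (hleft : (∃ w, w < a ∧ ∀ j, f j w - f j a ≤ L * (a - w)) ∨
      ∀ j, ∃ m, a ≤ m ∧ ∀ u, f j m ≤ f j u) :
    ∃ δ : J → ℝ, (∀ j, δ j ∈ Icc (-L) L ∧ IsSubderivative (f j) a (δ j)) ∧
      ∑ i, p i * δ (y i) ≤ 0 := by
  obtain ⟨δ, hδ, hs⟩ := exists_subderivative_sum_nonneg (L := L) (f := fun j u => f j (-u))
    (fun j => by
      have := (hf j).comp_linearMap (-LinearMap.id : ℝ →ₗ[ℝ] ℝ)
      simpa [Function.comp_def] using this) hp y (a := -a)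
    (fun u => by simpa using hmin (-u))
    (fun j => by
      obtain ⟨g, hg, h⟩ := hsub j
      exact ⟨-g, ⟨by linarith [hg.2], by linarith [hg.1]⟩, h.comp_neg⟩)
    (by
      rcases hleft with ⟨w, hw, h⟩ | h
      · refine Or.inl ⟨-w, by linarith, fun j => ?_⟩
        have := h j
        simp only [neg_neg]
        linarith
      · refine Or.inr fun j => ?_
        obtain ⟨m, hm, h⟩ := h j
        exact ⟨-m, by linarith, fun u => by simpa using h (-u)⟩)
  refine ⟨fun j => -δ j, fun j => ⟨⟨by linarith [(hδ j).1.2], by linarith [(hδ j).1.1]⟩, ?_⟩, ?_⟩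
  · simpa using (hδ j).2.comp_neg
  · simpa using hs

/-- Against finitely many weighted outcomes there is a prediction in `Y` with bounded
subderivatives whose weighted sum vanishes. -/
lemma IsAdmissibleLoss.exists_balanced_subderivative {Y : Set ℝ} {L : ℝ≥0} {ℓ : ℝ → ℝ → ℝ}
    (hℓ : IsAdmissibleLoss Y L ℓ) (hY : Y.Nonempty) {ι : Type*} [Fintype ι] {p : ι → ℝ}
    (hp : ∀ i, 0 ≤ p i) (y : ι → Y) :
    ∃ (a : Y) (δ : Y → ℝ),
      (∀ j : Y, δ j ∈ Icc (-(L : ℝ)) L ∧ IsSubderivative (fun u => ℓ u j) a (δ j)) ∧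
        ∑ i, p i * δ (y i) = 0 := by
  have hmin : ∃ a ∈ Y, ∀ u, ∑ i, p i * ℓ a (y i) ≤ ∑ i, p i * ℓ u (y i) := by
    -- Zero total weight must be allowed: `p` will be restricted to a single history, possibly one
    -- without mass.
    rcases (Finset.sum_nonneg fun i _ => hp i : 0 ≤ ∑ i, p i).eq_or_lt with h0 | hpos
    · obtain ⟨a, ha⟩ := hY
      have hz := (Finset.sum_eq_zero_iff_of_nonneg fun i _ => hp i).1 h0.symm
      refine ⟨a, ha, fun u => le_of_eq ?_⟩
      exact Finset.sum_congr rfl fun i hi => by rw [hz i hi, zero_mul, zero_mul]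
    · have hq : ∀ i, 0 ≤ p i / ∑ j, p j := fun i => div_nonneg (hp i) hpos.le
      obtain ⟨a, ha, h⟩ := hℓ.argmin_mem (weightedDirac (fun i => p i / ∑ j, p j) y)
        (isProbabilityMeasure_weightedDirac y hq (by rw [← Finset.sum_div, div_self hpos.ne']))
        fun u => integrable_weightedDirac y _
      refine ⟨a, ha, fun u => ?_⟩
      have h := h u
      rw [integral_weightedDirac y hq, integral_weightedDirac y hq] at h
      simp only [div_mul_eq_mul_div, ← Finset.sum_div] at h
      exact (div_le_div_iff_of_pos_right hpos).1 h
  -- Needed when `a` is an extreme point of `Y`, where the Lipschitz bound says nothing on the outer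
  -- side.
  have hpoint : ∀ j : Y, ∃ m ∈ Y, ∀ u, ℓ m j ≤ ℓ u j := by
    intro j
    obtain ⟨a, ha, h⟩ := hℓ.argmin_mem (Measure.dirac j) inferInstance
      fun u => integrable_dirac (by simp)
    exact ⟨a, ha, fun u => by simpa using h u⟩
  obtain ⟨a, ha, hmin⟩ := hmin
  have hlip : ∀ w ∈ Y, ∀ j : Y, ℓ w j - ℓ a j ≤ L * |w - a| := by
    intro w hw j
    have := (hℓ.lipschitz j j.2).dist_le_mul w hw a ha
    rw [Real.dist_eq, Real.dist_eq] at this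
    exact (le_abs_self _).trans this
  obtain ⟨δ₁, h₁, hs₁⟩ := exists_subderivative_sum_nonneg (L := L) (f := fun (j : Y) u => ℓ u j)
    (fun j => hℓ.convex j j.2) hp y hmin (fun j => hℓ.exists_subderivative a ha j j.2) (by
      by_cases h : ∃ w ∈ Y, a < w
      · obtain ⟨w, hw, haw⟩ := h
        refine Or.inl ⟨w, haw, fun j => ?_⟩
        simpa [abs_of_pos (sub_pos.2 haw)] using hlip w hw j
      · push Not at h
        refine Or.inr fun j => ?_
        obtain ⟨m, hm, h'⟩ := hpoint j
        exact ⟨m, h m hm, h'⟩)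
  obtain ⟨δ₂, h₂, hs₂⟩ := exists_subderivative_sum_nonpos (L := L) (f := fun (j : Y) u => ℓ u j)
    (fun j => hℓ.convex j j.2) hp y hmin (fun j => hℓ.exists_subderivative a ha j j.2) (by
      by_cases h : ∃ w ∈ Y, w < a
      · obtain ⟨w, hw, haw⟩ := h
        refine Or.inl ⟨w, haw, fun j => ?_⟩
        have := hlip w hw j
        rwa [abs_of_neg (sub_neg.2 haw), neg_sub] at this
      · push Not at h
        refine Or.inr fun j => ?_
        obtain ⟨m, hm, h'⟩ := hpoint j
        exact ⟨m, h m hm, h'⟩)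
  -- One pair of coefficients serves all outcomes, so the interpolated subderivative is still a
  -- function of the outcome alone.
  obtain ⟨s, t, hs, ht, hst, hz⟩ : ∃ s t : ℝ, 0 ≤ s ∧ 0 ≤ t ∧ s + t = 1 ∧
      s * (∑ i, p i * δ₂ (y i)) + t * (∑ i, p i * δ₁ (y i)) = 0 := by
    have : (0 : ℝ) ∈ segment ℝ (∑ i, p i * δ₂ (y i)) (∑ i, p i * δ₁ (y i)) := by
      rw [segment_eq_Icc (hs₂.trans hs₁)]
      exact ⟨hs₂, hs₁⟩
    obtain ⟨s, t, hs, ht, hst, h⟩ := this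
    exact ⟨s, t, hs, ht, hst, by simpa using h⟩
  refine ⟨⟨a, ha⟩, fun j => s * δ₂ j + t * δ₁ j, fun j => ⟨?_, ?_⟩, ?_⟩
  · exact convex_Icc _ _ (h₂ j).1 (h₁ j).1 hs ht hst
  · exact (h₂ j).2.convexComb (h₁ j).2 hs ht hst
  · rw [← hz, Finset.mul_sum, Finset.mul_sum, ← Finset.sum_add_distrib]
    exact Finset.sum_congr rfl fun i _ => by ring

/-! ### A minimax principle -/

/-- If no point of a compact convex set `K` of `ℝ^ι` is nonpositive, some weighting of the
coordinates is positive on `K`. -/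
lemma exists_weights_pos_of_forall_not_le {ι : Type*} [Fintype ι] {K : Set (ι → ℝ)}
    (hK : IsCompact K) (hKc : Convex ℝ K) (hKne : K.Nonempty) (h : ∀ v ∈ K, ¬ v ≤ 0) :
    ∃ p : ι → ℝ, (∀ i, 0 ≤ p i) ∧ ∑ i, p i = 1 ∧ ∀ v ∈ K, 0 < ∑ i, p i * v i := by
  classical
  obtain ⟨f, u, v, hu, huv, hv⟩ := geometric_hahn_banach_compact_closed hKc hK
    (convex_Iic (0 : ι → ℝ)) isClosed_Iic (Set.disjoint_left.2 fun a ha hn => h a ha hn)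
  have hf : ∀ w : ι → ℝ, f w = ∑ i, w i * f (Pi.single i 1) := by
    intro w
    conv_lhs => rw [pi_eq_sum_univ' w]
    simp [map_sum]
  have hv0 : v < 0 := by simpa using hv 0 (by simp)
  have hneg : ∀ i, f (Pi.single i 1) ≤ 0 := by
    intro i
    by_contra! hi
    -- If this coordinate of `f` were positive, the point would lie in the nonpositive orthant with
    -- `f`-value exactly `v`, against strict separation.
    have := hv (Pi.single i (v / f (Pi.single i 1))) (by
      rw [mem_Iic, Pi.single_nonpos]
      exact div_nonpos_of_nonpos_of_nonneg hv0.le hi.le)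
    rw [hf] at this
    simp only [Pi.single_apply, ite_mul, zero_mul, Finset.sum_ite_eq', Finset.mem_univ,
      if_true] at this
    have h1 : (Pi.single i (1 : ℝ) : ι → ℝ) = fun j => if j = i then 1 else 0 := by
      ext j; simp [Pi.single_apply]
    rw [h1] at this hi
    rw [div_mul_cancel₀ _ hi.ne'] at this
    exact lt_irrefl _ this
  have hKneg : ∀ w ∈ K, 0 < ∑ i, -f (Pi.single i 1) * w i := by
    intro w hw
    have := (hu w hw).trans (huv.trans hv0)
    rw [hf] at this
    have e : ∑ i, -f (Pi.single i 1) * w i = -∑ i, w i * f (Pi.single i 1) := by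
      rw [← Finset.sum_neg_distrib]
      exact Finset.sum_congr rfl fun i _ => by ring
    rw [e]
    linarith
  have hpos : 0 < ∑ i, -f (Pi.single i 1) := by
    refine (Finset.sum_nonneg fun i _ => by linarith [hneg i]).lt_of_ne' fun h0 => ?_
    have hz := (Finset.sum_eq_zero_iff_of_nonneg fun i _ => by linarith [hneg i]).1 h0
    obtain ⟨w, hw⟩ := hKne
    have := hKneg w hw
    rw [Finset.sum_eq_zero fun i hi => by rw [hz i hi, zero_mul]] at this
    exact lt_irrefl _ this
  refine ⟨fun i => -f (Pi.single i 1) / ∑ j, -f (Pi.single j 1),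
    fun i => div_nonneg (by linarith [hneg i]) hpos.le, ?_, fun w hw => ?_⟩
  · rw [← Finset.sum_div, div_self hpos.ne']
  · simp only [div_mul_eq_mul_div, ← Finset.sum_div]
    exact div_pos (hKneg w hw) hpos

/-- A one-sided minimax theorem for affine continuous payoffs on a compact space. -/
lemma exists_forall_nonpos_of_forall_weights {Q H : Type*} [TopologicalSpace Q] [CompactSpace Q]
    [Nonempty Q] {u : H → Q → ℝ} (hcont : ∀ h, Continuous (u h))
    (hconv : ∀ (q q' : Q) (a b : ℝ), 0 ≤ a → 0 ≤ b → a + b = 1 →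
      ∃ r, ∀ h, u h r = a * u h q + b * u h q')
    (hw : ∀ (s : Finset H) (p : s → ℝ), (∀ h, 0 ≤ p h) → ∑ h, p h = 1 →
      ∃ q, ∑ h, p h * u h q ≤ 0) :
    ∃ q, ∀ h, u h q ≤ 0 := by
  have hne : (⋂ h, {q | u h q ≤ 0}).Nonempty := by
    -- By compactness finitely many constraints `s` suffice. Their payoff vectors form a compact
    -- convex set; if it missed the nonpositive orthant, separating weights would contradict `hw`.
    refine CompactSpace.iInter_nonempty (fun h => isClosed_le (hcont h) continuous_const) ?_
    intro s
    by_contra hcon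
    obtain ⟨p, hp, hp1, hpos⟩ := exists_weights_pos_of_forall_not_le
      (K := range fun q (h : s) => u h q)
      (isCompact_range (continuous_pi fun h => hcont h))
      (by
        rintro _ ⟨q, rfl⟩ _ ⟨q', rfl⟩ a b ha hb hab
        obtain ⟨r, hr⟩ := hconv q q' a b ha hb hab
        exact ⟨r, funext fun h => by simp [hr]⟩)
      (range_nonempty _)
      (by
        rintro _ ⟨q, rfl⟩ hq
        exact hcon ⟨q, by simpa using fun h hh => hq ⟨h, hh⟩⟩)
    obtain ⟨q, hq⟩ := hw s p hp hp1
    exact absurd (hpos _ ⟨q, rfl⟩) (not_lt.2 hq)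
  obtain ⟨q, hq⟩ := hne
  exact ⟨q, fun h => mem_iInter.1 hq h⟩

/-! ### The expected loss of a strategy -/

section Strategy

variable {n : ℕ} {X : Type*} {Y : Set ℝ}

/-- The strategy that makes deterministic predictions. -/
def PredictionStrategy.pure (a : (t : Fin n) → (Fin (t + 1) → X) → (Fin t → Y) → Y) :
    PredictionStrategy n X Y :=
  fun t x y => diracProba (a t x y)

/-- Probability measures form a convex set. -/
def ProbabilityMeasure.convexComb {α : Type*} [MeasurableSpace α] (μ ν : ProbabilityMeasure α)
    {a b : ℝ} (hab : a + b = 1) (ha : 0 ≤ a) (hb : 0 ≤ b) : ProbabilityMeasure α :=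
  ⟨ENNReal.ofReal a • (μ : Measure α) + ENNReal.ofReal b • (ν : Measure α), ⟨by
    simp [← ENNReal.ofReal_add ha hb, hab]⟩⟩

lemma ProbabilityMeasure.integral_convexComb {α : Type*} [MeasurableSpace α]
    (μ ν : ProbabilityMeasure α) {a b : ℝ} (hab : a + b = 1) (ha : 0 ≤ a) (hb : 0 ≤ b)
    {f : α → ℝ} (hμ : Integrable f μ) (hν : Integrable f ν) :
    ∫ x, f x ∂(ProbabilityMeasure.convexComb μ ν hab ha hb : Measure α) =
      a * ∫ x, f x ∂(μ : Measure α) + b * ∫ x, f x ∂(ν : Measure α) := by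
  change ∫ x, f x ∂(ENNReal.ofReal a • (μ : Measure α) + ENNReal.ofReal b • (ν : Measure α)) = _
  rw [integral_add_measure (hμ.smul_measure ENNReal.ofReal_ne_top)
    (hν.smul_measure ENNReal.ofReal_ne_top), integral_smul_measure, integral_smul_measure,
    ENNReal.toReal_ofReal ha, ENNReal.toReal_ofReal hb, smul_eq_mul, smul_eq_mul]

/-- Each summand sees only one marginal of the product law. This makes the expected loss affine in
the strategy, although the product law itself is not. -/
lemma PredictionStrategy.integral_sum_law (q : PredictionStrategy n X Y) {f : Fin n → Y → ℝ}
    [CompactSpace Y] (hf : ∀ t, Continuous (f t)) (x : Fin n → X) (y : Fin n → Y) :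
    ∫ yhat, ∑ t, f t (yhat t) ∂(q.law x y) = ∑ t, ∫ a, f t a ∂(q t (upTo t x) (past t y)) := by
  have hint : ∀ t, Integrable (f t) (q t (upTo t x) (past t y)) := fun t =>
    (BoundedContinuousFunction.mkOfCompact ⟨f t, hf t⟩).integrable _
  unfold PredictionStrategy.law
  rw [integral_finsetSum _ fun t _ => integrable_comp_eval (hint t)]
  exact Finset.sum_congr rfl fun t _ => integral_comp_eval (hint t).1

/-- If every finite weighting of data sequences has a deterministic strategy of nonpositive expected
excess loss, some randomized strategy has nonpositive excess loss on every sequence. -/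
lemma PredictionStrategy.exists_achieves [CompactSpace Y] (hY : Y.Nonempty) {ℓ : ℝ → ℝ → ℝ}
    (hℓ : ∀ y : Y, Continuous fun a : Y => ℓ a y) (φ : (Fin n → X × Y) → ℝ)
    (h : ∀ (s : Finset ((Fin n → X) × (Fin n → Y))) (p : s → ℝ), (∀ i, 0 ≤ p i) → ∑ i, p i = 1 →
      ∃ a : (t : Fin n) → (Fin (t + 1) → X) → (Fin t → Y) → Y,
        ∑ i, p i * (∑ t, ℓ (a t (upTo t i.1.1) (past t i.1.2)) (i.1.2 t) -
          φ fun t => (i.1.1 t, i.1.2 t)) ≤ 0) :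
    ∃ q : PredictionStrategy n X Y, q.Achieves ℓ φ := by
  have hint : ∀ (μ : ProbabilityMeasure Y) (y : Y), Integrable (fun a : Y => ℓ a y) μ :=
    fun μ y => (BoundedContinuousFunction.mkOfCompact ⟨_, hℓ y⟩).integrable _
  have : Nonempty Y := hY.to_subtype
  have : Nonempty (PredictionStrategy n X Y) := ⟨.pure fun _ _ _ => Classical.arbitrary Y⟩
  suffices ∃ q : PredictionStrategy n X Y, ∀ i : (Fin n → X) × (Fin n → Y),
      (∑ t, ∫ a : Y, ℓ a (i.2 t) ∂(q t (upTo t i.1) (past t i.2) : Measure Y)) -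
        φ (fun t => (i.1 t, i.2 t)) ≤ 0 by
    obtain ⟨q, hq⟩ := this
    refine ⟨q, fun x y => ?_⟩
    rw [q.integral_sum_law (f := fun t a => ℓ a (y t)) fun t => hℓ (y t)]
    exact sub_nonpos.1 (hq (x, y))
  refine exists_forall_nonpos_of_forall_weights ?_ ?_ ?_
  · intro i
    refine (continuous_finsetSum _ fun t _ => ?_).sub continuous_const
    refine (ProbabilityMeasure.continuous_integral_boundedContinuousFunction
      (BoundedContinuousFunction.mkOfCompact ⟨_, hℓ (i.2 t)⟩)).comp (?_ : Continuous
        fun q : PredictionStrategy n X Y => q t (upTo t i.1) (past t i.2))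
    fun_prop
  · intro q q' a b ha hb hab
    refine ⟨fun t x y => ProbabilityMeasure.convexComb (q t x y) (q' t x y) hab ha hb, fun i => ?_⟩
    simp only [ProbabilityMeasure.integral_convexComb _ _ hab ha hb (hint _ _) (hint _ _)]
    rw [Finset.sum_add_distrib, ← Finset.mul_sum, ← Finset.mul_sum]
    linear_combination (φ fun t => (i.1 t, i.2 t)) * hab
  · intro s p hp hp1
    obtain ⟨a, ha⟩ := h s p hp hp1
    refine ⟨.pure a, ?_⟩
    convert ha using 6 with i _ t _
    simp [PredictionStrategy.pure, diracProba]

end Strategy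

/-! ### Finite martingale difference processes -/

/-- On a finite probability space with weights `p`, the real process `δ` has conditional mean zero
given its past and the past and present of the process `z`. -/
structure IsFiniteMartingaleDifference {ι Z : Type*} [Fintype ι] {n : ℕ} (p : ι → ℝ)
    (z : ι → Fin n → Z) (δ : ι → Fin n → ℝ) : Prop where
  nonneg : ∀ i, 0 ≤ p i
  sum_eq_one : ∑ i, p i = 1
  orthogonal : ∀ (t : Fin n) (g : (Fin (t + 1) → Z) → (Fin t → ℝ) → ℝ),
    ∑ i, p i * (g (upTo t (z i)) (past t (δ i)) * δ i t) = 0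

/-- Conditioning on a suitable value of `z` preserves the total mass and does not decrease the
weighted sum of `U`. -/
lemma exists_conditioning_le {ι Z : Type*} [Fintype ι] [DecidableEq Z] [Nonempty Z] {p : ι → ℝ}
    (hp : ∀ i, 0 ≤ p i) (z : ι → Z) (U : ι → ℝ) :
    ∃ (ζ : Z) (r : ℝ), 0 ≤ r ∧ ∑ i, p i * (if z i = ζ then r else 0) = ∑ i, p i ∧
      ∑ i, p i * U i ≤ ∑ i, p i * (if z i = ζ then r else 0) * U i := by
  classical
  rcases (Finset.sum_nonneg fun i _ => hp i : 0 ≤ ∑ i, p i).eq_or_lt with h0 | hpos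
  · have hz := (Finset.sum_eq_zero_iff_of_nonneg fun i _ => hp i).1 h0.symm
    refine ⟨Classical.arbitrary Z, 0, le_rfl, ?_, ?_⟩ <;> simp [fun i => hz i (Finset.mem_univ i)]
  set A : Z → ℝ := fun ζ => ∑ i with p i ≠ 0 ∧ z i = ζ, p i with hA
  set B : Z → ℝ := fun ζ => ∑ i with p i ≠ 0 ∧ z i = ζ, p i * U i with hB
  set F : Finset Z := Finset.image z {i | p i ≠ 0} with hF
  have hsum : ∀ f : ι → ℝ, ∑ i, p i * f i =
      ∑ ζ ∈ F, ∑ i with p i ≠ 0 ∧ z i = ζ, p i * f i := by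
    intro f
    simp only [← Finset.filter_filter]
    rw [Finset.sum_fiberwise_of_maps_to fun i hi => Finset.mem_image_of_mem z hi]
    refine (Finset.sum_filter_of_ne fun i _ h => ?_).symm
    exact left_ne_zero_of_mul h
  have hM : ∑ i, p i = ∑ ζ ∈ F, A ζ := by simpa using hsum fun _ => 1
  have hS : ∑ i, p i * U i = ∑ ζ ∈ F, B ζ := hsum U
  have hFne : F.Nonempty := by
    by_contra h
    rw [Finset.not_nonempty_iff_eq_empty.1 h] at hM
    simp at hM
    linarith
  -- On some fibre of `z` the average of `U` is at least the overall average, written without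
  -- division.
  obtain ⟨ζ, hζ, hle⟩ := Finset.exists_le_of_sum_le hFne
    (f := fun ζ => (∑ i, p i * U i) * A ζ) (g := fun ζ => B ζ * ∑ i, p i)
    (by rw [← Finset.mul_sum, ← Finset.sum_mul, ← hM, ← hS])
  have hApos : 0 < A ζ := by
    obtain ⟨i, hi, rfl⟩ := Finset.mem_image.1 hζ
    refine Finset.sum_pos (fun j hj => (hp j).lt_of_ne' (Finset.mem_filter.1 hj).2.1) ⟨i, ?_⟩
    simpa using hi
  have hite : ∀ f : ι → ℝ, ∑ i, p i * (if z i = ζ then (∑ i, p i) / A ζ else 0) * f i =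
      (∑ i with p i ≠ 0 ∧ z i = ζ, p i * f i) * ((∑ i, p i) / A ζ) := by
    intro f
    rw [Finset.sum_mul, Finset.sum_filter]
    refine Finset.sum_congr rfl fun i _ => ?_
    by_cases h1 : p i = 0 <;> by_cases h2 : z i = ζ <;> simp [h1, h2]
    ring
  refine ⟨ζ, (∑ i, p i) / A ζ, div_nonneg hpos.le hApos.le, ?_, ?_⟩
  · have := hite fun _ => 1
    simp only [mul_one] at this
    rw [this]
    exact mul_div_cancel₀ _ hApos.ne'
  · rw [hite, ← mul_div_assoc, le_div_iff₀ hApos]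
    exact hle

/-- Conditioning simultaneously on a value of `z` for each value of `d`. -/
lemma exists_fiberwise_conditioning_le {ι Z D : Type*} [Fintype ι] [DecidableEq Z] [Nonempty Z]
    {p : ι → ℝ} (hp : ∀ i, 0 ≤ p i) (z : ι → Z) (d : ι → D) (U : ι → ℝ) :
    ∃ (ζ : D → Z) (r : D → ℝ), (∀ x, 0 ≤ r x) ∧
      (∀ H : D → ℝ, ∑ i, p i * (if z i = ζ (d i) then r (d i) else 0) * H (d i) =
        ∑ i, p i * H (d i)) ∧
      ∑ i, p i * U i ≤ ∑ i, p i * (if z i = ζ (d i) then r (d i) else 0) * U i := by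
  classical
  choose ζ r hr hmass hval using fun x : D =>
    exists_conditioning_le (p := fun i => if d i = x then p i else 0)
      (fun i => by split_ifs; exacts [hp i, le_rfl]) z U
  have hfib : ∀ f : ι → ℝ, ∑ i, f i =
      ∑ x ∈ Finset.univ.image d, ∑ i, if d i = x then f i else 0 := by
    intro f
    rw [← Finset.sum_fiberwise_of_maps_to fun i hi => Finset.mem_image_of_mem d hi]
    simp only [Finset.sum_filter]
  refine ⟨ζ, r, hr, fun H => ?_, ?_⟩
  · rw [hfib, hfib fun i => p i * H (d i)]
    refine Finset.sum_congr rfl fun x _ => ?_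
    have := congrArg (· * H x) (hmass x)
    simp only [Finset.sum_mul] at this
    refine Eq.trans (Finset.sum_congr rfl fun i _ => ?_)
      (this.trans (Finset.sum_congr rfl fun i _ => ?_)) <;>
    by_cases h : d i = x <;> simp [h]
  · rw [hfib, hfib fun i => p i * (if z i = ζ (d i) then r (d i) else 0) * U i]
    refine Finset.sum_le_sum fun x _ => ?_
    refine (Finset.sum_congr rfl fun i _ => ?_).trans_le
      ((hval x).trans_eq (Finset.sum_congr rfl fun i _ => ?_)) <;>
    by_cases h : d i = x <;> simp [h]

/-- A finite martingale difference process can be conditioned so that `z` becomes a function of the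
past of `δ`, without decreasing the expectation of `U`. -/
theorem IsFiniteMartingaleDifference.exists_predictable {ι Z : Type*} [Fintype ι] {n : ℕ}
    {p : ι → ℝ} {z : ι → Fin n → Z} {δ : ι → Fin n → ℝ}
    (h : IsFiniteMartingaleDifference p z δ) (U : ι → ℝ) :
    ∃ p' : ι → ℝ, IsFiniteMartingaleDifference p' z δ ∧ (∀ i, p i = 0 → p' i = 0) ∧
      ∑ i, p i * U i ≤ ∑ i, p' i * U i ∧
      ∃ f : (t : Fin n) → (Fin t → ℝ) → Z, ∀ i, p' i ≠ 0 → ∀ t, z i t = f t (past t (δ i)) := by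
  classical
  suffices H : ∀ m ≤ n, ∃ p' : ι → ℝ, IsFiniteMartingaleDifference p' z δ ∧
      (∀ i, p i = 0 → p' i = 0) ∧ ∑ i, p i * U i ≤ ∑ i, p' i * U i ∧
      ∀ t : Fin n, (t : ℕ) < m → ∃ f : (Fin t → ℝ) → Z, ∀ i, p' i ≠ 0 →
        z i t = f (past t (δ i)) by
    obtain ⟨p', h1, h2, h3, h4⟩ := H n le_rfl
    choose f hf using fun t : Fin n => h4 t t.2
    exact ⟨p', h1, h2, h3, f, fun i hi t => hf t i hi⟩
  intro m
  induction m with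
  | zero => exact fun _ => ⟨p, h, fun _ => id, le_rfl, fun t ht => absurd ht (Nat.not_lt_zero _)⟩
  | succ m ih =>
    intro hm
    obtain ⟨p', h1, h2, h3, h4⟩ := ih (Nat.le_of_succ_le hm)
    choose f hf using h4
    set t : Fin n := ⟨m, hm⟩ with ht
    have hι : Nonempty ι := by
      by_contra hcon
      rw [not_nonempty_iff] at hcon
      simpa using h.sum_eq_one
    have hZ : Nonempty Z := ⟨z hι.some t⟩
    obtain ⟨ζ, r, hr, hmass, hval⟩ := exists_fiberwise_conditioning_le h1.nonneg
      (fun i => z i t) (fun i => past t (δ i)) U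
    refine ⟨fun i => p' i * (if z i t = ζ (past t (δ i)) then r (past t (δ i)) else 0),
      ⟨fun i => mul_nonneg (h1.nonneg i) ?_, ?_, fun s g => ?_⟩, fun i hi => ?_, h3.trans hval, ?_⟩
    · split_ifs
      exacts [hr _, le_rfl]
    · simpa [h1.sum_eq_one] using hmass fun _ => 1
    -- For `s < m`, `z` up to `s` is already a function of the past of `δ` on the support, and the
    -- reweighting preserves the law of `past t δ`, which includes `δ s`. For `s ≥ m`, the new
    -- density depends only on `z` up to `s` and the past of `δ` before `s`, so it is absorbed into
    -- `g`.
    · rcases lt_or_ge (s : ℕ) m with hs | hs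
      · let w : (Fin s → ℝ) → Fin (s + 1) → Z := fun e j =>
          f ⟨j, by omega⟩ (by simp; omega) fun k => e ⟨k, lt_of_lt_of_le k.2 (Nat.lt_succ_iff.1 j.2)⟩
        have hw : ∀ i, p' i ≠ 0 → upTo s (z i) = w (past s (δ i)) := by
          intro i hi
          funext j
          exact hf ⟨j, by omega⟩ (by simp; omega) i hi
        have e1 : ∀ (k : ι → ℝ) i, p' i * k i * (g (upTo s (z i)) (past s (δ i)) * δ i s) =
            p' i * k i * (g (w (past s (δ i))) (past s (δ i)) * δ i s) := by
          intro k i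
          by_cases hi : p' i = 0
          · simp [hi]
          · rw [hw i hi]
        refine (Finset.sum_congr rfl fun i _ => e1 (fun i =>
          if z i t = ζ (past t (δ i)) then r (past t (δ i)) else 0) i).trans ?_
        refine (hmass fun e => g (w fun k => e ⟨k, lt_trans k.2 hs⟩)
          (fun k => e ⟨k, lt_trans k.2 hs⟩) * e ⟨s, hs⟩).trans ?_
        exact h1.orthogonal s fun _ e => g (w e) e
      · refine (Finset.sum_congr rfl fun i _ => ?_).trans (h1.orthogonal s fun a e =>
          (if a ⟨m, Nat.lt_succ_iff.2 hs⟩ = ζ (fun k => e ⟨k, lt_of_lt_of_le k.2 hs⟩)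
            then r (fun k => e ⟨k, lt_of_lt_of_le k.2 hs⟩) else 0) * g a e)
        rw [mul_assoc, mul_assoc]
        rfl
    · simp [h2 i hi]
    · intro s hs
      rcases (Nat.lt_succ_iff.1 hs).lt_or_eq with hs | hs
      · exact ⟨f s hs, fun i hi => hf s hs i (left_ne_zero_of_mul hi)⟩
      · obtain rfl : s = t := Fin.ext hs
        refine ⟨ζ, fun i hi => ?_⟩
        by_contra hne
        exact hi (by simp [hne])

/-- A process that is a function of the past of finitely many paths agrees on these paths with a
predictable sequence. -/
lemma exists_predictableSequence {ι Z : Type*} [Finite ι] [MeasurableSpace Z] {n : ℕ}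
    (hZ : Fin n → Nonempty Z) (f : (t : Fin n) → (Fin t → ℝ) → Z) (δ : ι → Fin n → ℝ) :
    ∃ z : PredictableSequence n Z, ∀ t i, z.toFun t (past t (δ i)) = f t (past t (δ i)) := by
  classical
  -- Constant off a finite set, hence measurable for any σ-algebra on `Z`.
  refine ⟨⟨fun t e => if e ∈ range fun i => past t (δ i) then f t e else (hZ t).some,
    fun t => ?_⟩, fun t i => if_pos ⟨i, rfl⟩⟩
  refine (measurable_const (a := (hZ t).some)).measurable_of_countable_ne
    ((finite_range fun i => past t (δ i)).countable.mono fun e he => ?_)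
  by_contra hcon
  exact he (if_neg hcon).symm

/-- The law of a bounded finite martingale difference process. -/
lemma IsFiniteMartingaleDifference.isMartingaleDifferenceLaw {ι Z : Type*} [Fintype ι] {n : ℕ}
    {p : ι → ℝ} {z : ι → Fin n → Z} {δ : ι → Fin n → ℝ}
    (h : IsFiniteMartingaleDifference p z δ) {L : ℝ≥0}
    (hδ : ∀ i, p i ≠ 0 → ∀ t, δ i t ∈ Icc (-(L : ℝ)) L) :
    IsMartingaleDifferenceLaw L (weightedDirac p δ) := by
  have hprob := isProbabilityMeasure_weightedDirac δ h.nonneg h.sum_eq_one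
  refine ⟨hprob, ae_weightedDirac δ hδ, fun t => ?_⟩
  have hmeas : Measurable (past t : (Fin n → ℝ) → Fin t → ℝ) :=
    measurable_pi_lambda _ fun s => measurable_pi_apply _
  symm
  refine ae_eq_condExp_of_forall_setIntegral_eq hmeas.comap_le
    (integrable_weightedDirac δ _) (fun s _ _ => integrableOn_zero) ?_
    aestronglyMeasurable_zero
  rintro s ⟨B, hB, rfl⟩ -
  classical
  rw [← integral_indicator (hmeas hB), ← integral_indicator (hmeas hB),
    integral_weightedDirac δ h.nonneg, integral_weightedDirac δ h.nonneg]
  have := h.orthogonal t fun _ e => if e ∈ B then 1 else 0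
  simp only [ite_mul, one_mul, zero_mul] at this
  simpa [indicator_apply] using this.symm

section

variable {ι Z 𝒯 : Type*} [Fintype ι] [MeasurableSpace Z] [AddCommGroup 𝒯] {n : ℕ} {p : ι → ℝ}
  {z : ι → Fin n → Z} {δ : ι → Fin n → ℝ}

/-- Every finite martingale difference process has an expected statistic dominated by that of a
predictable sequence. -/
lemma IsFiniteMartingaleDifference.exists_predictableSequence_le
    (h : IsFiniteMartingaleDifference p z δ) (W : ((t : Fin n) → Z) → (Fin n → ℝ) → ℝ) :
    ∃ (p' : ι → ℝ) (z' : PredictableSequence n Z), IsFiniteMartingaleDifference p' z δ ∧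
      (∀ i, p i = 0 → p' i = 0) ∧
      ∑ i, p i * W (z i) (δ i) ≤
        ∑ i, p' i * W (fun t => z'.toFun t (past t (δ i))) (δ i) := by
  obtain ⟨p', h', h0, hle, f, hf⟩ := h.exists_predictable fun i => W (z i) (δ i)
  have hι : Nonempty ι := by
    by_contra hcon
    rw [not_nonempty_iff] at hcon
    simpa using h.sum_eq_one
  obtain ⟨z', hz'⟩ := exists_predictableSequence (fun t => ⟨z hι.some t⟩) f δ
  refine ⟨p', z', h', h0, hle.trans_eq (Finset.sum_congr rfl fun i _ => ?_)⟩
  by_cases hi : p' i = 0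
  · simp [hi]
  · have : z i = fun t => z'.toFun t (past t (δ i)) :=
      funext fun t => (hf i hi t).trans (hz' t i).symm
    rw [← this]

/-- After conditioning, `z` is predictable and the law of `δ` is finitely supported, so `hV`
applies. -/
lemma IsFiniteMartingaleDifference.sum_statistic_nonpos
    (h : IsFiniteMartingaleDifference p z δ) {L : ℝ≥0} (hδ : ∀ i t, δ i t ∈ Icc (-(L : ℝ)) L)
    {T : Z → ℝ → 𝒯} {V : 𝒯 → ℝ}
    (hV : ∀ (z : PredictableSequence n Z) (μ : Measure (Fin n → ℝ)),
      IsMartingaleDifferenceLaw L μ → Integrable (statisticValue T V z) μ →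
        ∫ δ, statisticValue T V z δ ∂μ ≤ 0) :
    ∑ i, p i * V (∑ t, T (z i t) (δ i t)) ≤ 0 := by
  obtain ⟨p', z', h', -, hle⟩ :=
    h.exists_predictableSequence_le fun ζ η => V (∑ t, T (ζ t) (η t))
  refine hle.trans ?_
  have := hV z' (weightedDirac p' δ) (h'.isMartingaleDifferenceLaw fun i _ => hδ i)
    (integrable_weightedDirac δ _)
  rwa [integral_weightedDirac δ h'.nonneg] at this

end

/-! ### Reduction to Rademacher variables -/

/-- The sign `1` or `-1`. -/
def boolSign (b : Bool) : ℝ := cond b 1 (-1)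

@[simp] lemma boolSign_true : boolSign true = 1 := rfl

@[simp] lemma boolSign_false : boolSign false = -1 := rfl

lemma pi_rademacher_eq (n : ℕ) : Measure.pi (fun _ : Fin n => rademacher) =
    weightedDirac (fun _ : Fin n → Bool => (2⁻¹ : ℝ) ^ n) fun b t => boolSign (b t) := by
  have : IsProbabilityMeasure rademacher := ⟨by simp [rademacher, ENNReal.inv_two_add_inv_two]⟩
  refine Measure.pi_eq fun s hs => ?_
  have h1 : ∀ t, rademacher (s t) =
      ∑ b : Bool, (2⁻¹ : ℝ≥0∞) * (s t).indicator 1 (boolSign b) := by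
    intro t
    simp [rademacher, hs t]
  have h2 : ENNReal.ofReal ((2⁻¹ : ℝ) ^ n) = (2⁻¹ : ℝ≥0∞) ^ n := by
    rw [ENNReal.ofReal_pow (by norm_num), ENNReal.ofReal_inv_of_pos (by norm_num),
      ENNReal.ofReal_ofNat]
  simp only [h1]
  rw [Finset.prod_univ_sum]
  simp only [weightedDirac, Measure.coe_finsetSum, Measure.coe_smul, Finset.sum_apply,
    Pi.smul_apply, smul_eq_mul, Fintype.piFinset_univ]
  refine Finset.sum_congr rfl fun b _ => ?_
  rw [Measure.dirac_apply' _ (MeasurableSet.univ_pi hs), Finset.prod_mul_distrib, h2]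
  congr 1
  · simp
  · classical
    simp only [indicator_apply, Pi.one_apply, Finset.prod_ite_zero, Finset.prod_const_one]
    simp

section

variable {ι Z : Type*} [Fintype ι] {n : ℕ} {p : ι → ℝ} {z : ι → Fin n → Z} {δ : ι → Fin n → ℝ}

/-- The expectation of `∏ (1 + e t * δ t) / 2` is that of a product of independent factors. -/
lemma IsFiniteMartingaleDifference.sum_mul_prod (h : IsFiniteMartingaleDifference p z δ)
    (e : ℕ → ℝ) {m : ℕ} (hm : m ≤ n) :
    ∑ i, p i * ∏ t : Fin m, ((1 + e t * δ i (t.castLE hm)) / 2) = (2⁻¹ : ℝ) ^ m := by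
  induction m with
  | zero => simp [h.sum_eq_one]
  | succ m ih =>
    have h1 := ih (Nat.le_of_succ_le hm)
    -- The last factor is `1 / 2` plus a multiple of `δ m`, which is orthogonal to the earlier
    -- factors.
    have h2 := h.orthogonal ⟨m, hm⟩ fun _ a => ∏ t : Fin m, ((1 + e t * a t) / 2)
    have h3 : ∀ i, p i * ∏ t : Fin (m + 1), ((1 + e t * δ i (t.castLE hm)) / 2) =
        2⁻¹ * (p i * ∏ t : Fin m, ((1 + e t * δ i (t.castLE (Nat.le_of_succ_le hm))) / 2)) +
        e m / 2 * (p i * ((∏ t : Fin m, ((1 + e t * past ⟨m, hm⟩ (δ i) t) / 2)) *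
          δ i ⟨m, hm⟩)) := by
      intro i
      rw [Fin.prod_univ_castSucc]
      change p i * ((∏ t : Fin m, ((1 + e t * past ⟨m, hm⟩ (δ i) t) / 2)) *
        ((1 + e m * δ i ⟨m, hm⟩) / 2)) = 2⁻¹ * (p i *
          ∏ t : Fin m, ((1 + e t * past ⟨m, hm⟩ (δ i) t) / 2)) + _
      ring
    simp only [h3]
    rw [Finset.sum_add_distrib, ← Finset.mul_sum, ← Finset.mul_sum, h1, h2, pow_succ]
    ring

/-- A martingale difference process of signs is a sequence of independent Rademacher variables. -/
lemma IsFiniteMartingaleDifference.sum_eq_integral_rademacher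
    (h : IsFiniteMartingaleDifference p z δ) (hδ : ∀ i t, δ i t = 1 ∨ δ i t = -1)
    (F : (Fin n → ℝ) → ℝ) :
    ∑ i, p i * F (δ i) = ∫ ε, F ε ∂(Measure.pi fun _ : Fin n => rademacher) := by
  rw [pi_rademacher_eq, integral_weightedDirac _ fun _ => by positivity]
  -- For signs the product is the indicator of `δ i` being the pattern `b`, so every pattern has
  -- probability `2⁻¹ ^ n`.
  have hmass : ∀ b : Fin n → Bool,
      ∑ i, p i * ∏ t, ((1 + boolSign (b t) * δ i t) / 2) = (2⁻¹ : ℝ) ^ n := by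
    intro b
    have := h.sum_mul_prod (fun m => if hm : m < n then boolSign (b ⟨m, hm⟩) else 0) le_rfl
    simpa using this
  have hF : ∀ i, F (δ i) = ∑ b : Fin n → Bool,
      (∏ t, ((1 + boolSign (b t) * δ i t) / 2)) * F fun t => boolSign (b t) := by
    intro i
    obtain ⟨c, hc⟩ : ∃ c : Fin n → Bool, δ i = fun t => boolSign (c t) := by
      have : ∀ t, ∃ b : Bool, δ i t = boolSign b := fun t => by
        rcases hδ i t with h | h
        exacts [⟨true, h⟩, ⟨false, h⟩]
      choose c hc using this
      exact ⟨c, funext hc⟩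
    rw [Finset.sum_eq_single c]
    · rw [← hc, Finset.prod_eq_one, one_mul]
      intro t _
      rw [hc]
      dsimp only
      cases c t <;> norm_num
    · intro b _ hb
      obtain ⟨t, ht⟩ := Function.ne_iff.1 hb
      rw [Finset.prod_eq_zero (Finset.mem_univ t), zero_mul]
      rw [hc]
      revert ht
      dsimp only
      cases c t <;> cases b t <;> simp
    · simp
  calc ∑ i, p i * F (δ i)
      = ∑ i, ∑ b : Fin n → Bool, p i *
          (∏ t, ((1 + boolSign (b t) * δ i t) / 2)) * F fun t => boolSign (b t) := by
        refine Finset.sum_congr rfl fun i _ => ?_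
        rw [hF i, Finset.mul_sum]
        exact Finset.sum_congr rfl fun b _ => (mul_assoc _ _ _).symm
    _ = _ := by
        rw [Finset.sum_comm]
        refine Finset.sum_congr rfl fun b _ => ?_
        rw [← Finset.sum_mul, hmass]

/-- Replacing one coordinate of a `[-1, 1]`-valued martingale difference process by a random sign
with the same conditional mean. -/
lemma IsFiniteMartingaleDifference.update_sign (h : IsFiniteMartingaleDifference p z δ)
    (hδ : ∀ i t, δ i t ∈ Icc (-1 : ℝ) 1) (t : Fin n) :
    IsFiniteMartingaleDifference
      (fun k : ι × Bool => p k.1 * ((1 + boolSign k.2 * δ k.1 t) / 2)) (fun k => z k.1)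
      fun k => Function.update (δ k.1) t (boolSign k.2) := by
  refine ⟨?_, ?_, fun s g => ?_⟩
  · rintro ⟨i, b⟩
    refine mul_nonneg (h.nonneg i) (div_nonneg ?_ zero_le_two)
    have := hδ i t
    cases b <;> simp <;> linarith [this.1, this.2]
  · rw [Fintype.sum_prod_type]
    refine (Finset.sum_congr rfl fun i _ => ?_).trans h.sum_eq_one
    simp only [Fintype.sum_bool, boolSign_true, boolSign_false]
    ring
  -- For `t < s` and a fixed sign, the new weight and the new past are functions of the old past.
  -- For `s ≤ t` the past is unchanged, and summing over the sign restores the weight, or `δ t`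
  -- itself when `s = t`.
  · rcases lt_or_ge t s with hts | hst
    · rw [Fintype.sum_prod_type_right]
      refine Finset.sum_eq_zero fun b _ => ?_
      refine (Finset.sum_congr rfl fun i _ => ?_).trans (h.orthogonal s fun a e =>
        (1 + boolSign b * e ⟨t, hts⟩) / 2 * g a (Function.update e ⟨t, hts⟩ (boolSign b)))
      have h1 : past s (Function.update (δ i) t (boolSign b)) =
          Function.update (past s (δ i)) ⟨t, hts⟩ (boolSign b) := by
        funext k
        by_cases hk : k = ⟨t, hts⟩
        · subst hk
          simp [past]
        · rw [Function.update_of_ne hk]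
          exact Function.update_of_ne (a := k.castLE s.isLt.le)
            (fun hc => hk (Fin.ext (show (k.castLE s.isLt.le : ℕ) = t from hc ▸ rfl))) _ (δ i)
      dsimp only
      rw [h1, Function.update_of_ne hts.ne', show past s (δ i) ⟨t, hts⟩ = δ i t from rfl]
      ring
    · have h1 : ∀ i (a : ℝ), past s (Function.update (δ i) t a) = past s (δ i) := by
        intro i a
        funext k
        refine Function.update_of_ne (fun hc => ?_) _ _
        have h2 : (k : ℕ) = t := Fin.ext_iff.1 hc
        exact absurd (h2.symm.trans_lt k.2) (not_lt.2 hst)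
      rw [Fintype.sum_prod_type, ← h.orthogonal s g]
      refine Finset.sum_congr rfl fun i _ => ?_
      simp only [h1, Fintype.sum_bool, boolSign_true, boolSign_false]
      rcases hst.lt_or_eq with hst | rfl
      · rw [Function.update_of_ne hst.ne, Function.update_of_ne hst.ne]
        ring
      · rw [Function.update_self, Function.update_self]
        ring

end

/-- Jensen's inequality for the random sign with mean `x`. -/
lemma ConvexOn.le_sum_boolSign {f : ℝ → ℝ} (hf : ConvexOn ℝ (Icc (-1) 1) f) {x : ℝ}
    (hx : x ∈ Icc (-1 : ℝ) 1) :
    f x ≤ ∑ b : Bool, (1 + boolSign b * x) / 2 * f (boolSign b) := by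
  have := hf.2 (show (1 : ℝ) ∈ Icc (-1) 1 by simp) (show (-1 : ℝ) ∈ Icc (-1) 1 by simp)
    (show 0 ≤ (1 + x) / 2 by linarith [hx.1]) (show 0 ≤ (1 - x) / 2 by linarith [hx.2]) (by ring)
  simp only [smul_eq_mul] at this
  rw [show (1 + x) / 2 * 1 + (1 - x) / 2 * -1 = x by ring] at this
  rw [Fintype.sum_bool]
  refine this.trans_eq ?_
  simp only [boolSign_true, boolSign_false]
  ring

/-- A separately convex functional with nonpositive expectation over all martingale difference
processes of signs has nonpositive expectation over all `[-1, 1]`-valued ones. -/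
lemma sum_nonpos_of_separately_convex.{u} {Z : Type*} {n : ℕ} {W : (Fin n → Z) → (Fin n → ℝ) → ℝ}
    (hW : ∀ ζ η t, ConvexOn ℝ (Icc (-1) 1) fun α => W ζ (Function.update η t α))
    (hsign : ∀ {ι : Type u} [Fintype ι] {p : ι → ℝ} {z : ι → Fin n → Z} {δ : ι → Fin n → ℝ},
      IsFiniteMartingaleDifference p z δ → (∀ i t, δ i t = 1 ∨ δ i t = -1) →
        ∑ i, p i * W (z i) (δ i) ≤ 0)
    {ι : Type u} [Fintype ι] {p : ι → ℝ} {z : ι → Fin n → Z} {δ : ι → Fin n → ℝ}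
    (h : IsFiniteMartingaleDifference p z δ) (hδ : ∀ i t, δ i t ∈ Icc (-1 : ℝ) 1) :
    ∑ i, p i * W (z i) (δ i) ≤ 0 := by
  -- Signs are introduced from the last coordinate backwards; `ι` is generalized because each
  -- replacement turns it into `ι × Bool`.
  suffices H : ∀ (m : ℕ) {ι : Type u} [Fintype ι] {p : ι → ℝ} {z : ι → Fin n → Z}
      {δ : ι → Fin n → ℝ}, IsFiniteMartingaleDifference p z δ →
      (∀ i t, δ i t ∈ Icc (-1 : ℝ) 1) →
      (∀ i (t : Fin n), m ≤ (t : ℕ) → δ i t = 1 ∨ δ i t = -1) →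
      ∑ i, p i * W (z i) (δ i) ≤ 0 from
    H n h hδ fun _ t ht => absurd t.2 (not_lt.2 ht)
  clear h hδ
  intro m
  induction m with
  | zero => exact fun h _ hs => hsign h fun i t => hs i t (Nat.zero_le _)
  | succ m ih =>
    intro ι _ p z δ h hδ hs
    rcases lt_or_ge m n with hm | hm
    · refine le_trans ?_ (ih (h.update_sign hδ ⟨m, hm⟩) ?_ ?_)
      · rw [Fintype.sum_prod_type]
        refine Finset.sum_le_sum fun i _ => ?_
        have := (hW (z i) (δ i) ⟨m, hm⟩).le_sum_boolSign (hδ i ⟨m, hm⟩)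
        rw [Function.update_eq_self] at this
        refine (mul_le_mul_of_nonneg_left this (h.nonneg i)).trans_eq ?_
        rw [Finset.mul_sum]
        exact Finset.sum_congr rfl fun b _ => (mul_assoc _ _ _).symm
      · rintro ⟨i, b⟩ t
        by_cases ht : t = ⟨m, hm⟩
        · subst ht
          cases b <;> simp
        · simpa [Function.update_of_ne ht] using hδ i t
      · rintro ⟨i, b⟩ t hmt
        by_cases ht : t = ⟨m, hm⟩
        · subst ht
          cases b <;> simp
        · simp only [Function.update_of_ne ht]
          refine hs i t (lt_of_le_of_ne hmt fun hc => ht (Fin.ext hc.symm))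
    · exact ih h hδ fun i t ht => absurd t.2 (not_lt.2 (hm.trans ht))

/-! ### Responding to a known mixture, and the conclusion -/

/-- Against finitely many weighted data sequences, a deterministic strategy reduces the excess loss
to a martingale transform of the statistic. -/
lemma exists_response_nonpos {X 𝒯 : Type*} [AddCommGroup 𝒯] {n : ℕ} {Y : Set ℝ} (hY : Y.Nonempty)
    {L : ℝ≥0} {ℓ : ℝ → ℝ → ℝ} (hℓ : IsAdmissibleLoss Y L ℓ) {φ : (Fin n → X × Y) → ℝ}
    {T : X × Y → ℝ → 𝒯} {V : 𝒯 → ℝ} (hTV : IsSufficientStatisticPair L ℓ φ T V)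
    {ι : Type*} [Fintype ι] {p : ι → ℝ} (hp : ∀ i, 0 ≤ p i) (hp1 : ∑ i, p i = 1)
    (x : ι → Fin n → X) (y : ι → Fin n → Y)
    (hmart : ∀ (z : ι → Fin n → X × Y) (δ : ι → Fin n → ℝ),
      IsFiniteMartingaleDifference p z δ → (∀ i t, δ i t ∈ Icc (-(L : ℝ)) L) →
        ∑ i, p i * V (∑ t, T (z i t) (δ i t)) ≤ 0) :
    ∃ a : (t : Fin n) → (Fin (t + 1) → X) → (Fin t → Y) → Y,
      ∑ i, p i * (∑ t, ℓ (a t (upTo t (x i)) (past t (y i))) (y i t) -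
        φ fun t => (x i t, y i t)) ≤ 0 := by
  classical
  -- The weights restricted to one history are the unnormalized conditional law of `y t`.
  choose a δ hδ hbal using fun (t : Fin n) (ξ : Fin (t + 1) → X) (η : Fin t → Y) =>
    hℓ.exists_balanced_subderivative hY
      (p := fun i => if upTo t (x i) = ξ ∧ past t (y i) = η then p i else 0)
      (fun i => by split_ifs; exacts [hp i, le_rfl]) fun i => y i t
  refine ⟨a, (Finset.sum_le_sum fun i _ => mul_le_mul_of_nonneg_left
    (hTV (x i) (fun t => a t (upTo t (x i)) (past t (y i))) (y i)
      (fun t => δ t (upTo t (x i)) (past t (y i)) (y i t)) fun t => hδ t _ _ _) (hp i)).trans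
    (hmart (fun i t => (x i t, a t (upTo t (x i)) (past t (y i)))) _ ⟨hp, hp1, fun t g => ?_⟩
      fun i t => (hδ t _ _ _).1)⟩
  -- `z` up to `t` and the past of `δ` are functions of the history, so `g` is constant on each
  -- history and `hbal` annihilates the sum there.
  let zOf : (Fin (t + 1) → X) → (Fin t → Y) → Fin (t + 1) → X × Y := fun ξ η s =>
    (ξ s, a ⟨s, lt_of_lt_of_le s.2 t.2⟩ (fun k => ξ ⟨k, lt_of_lt_of_le k.2 s.2⟩)
      fun k => η ⟨k, lt_of_lt_of_le k.2 (Nat.lt_succ_iff.1 s.2)⟩)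
  let δOf : (Fin (t + 1) → X) → (Fin t → Y) → Fin t → ℝ := fun ξ η s =>
    δ ⟨s, s.2.trans t.2⟩ (fun k => ξ ⟨k, lt_of_lt_of_le k.2 (Nat.succ_le_succ s.2.le)⟩)
      (fun k => η ⟨k, k.2.trans s.2⟩) (η s)
  rw [← Finset.sum_fiberwise_of_maps_to (t := Finset.univ.image fun i =>
    (upTo t (x i), past t (y i))) fun i hi => Finset.mem_image_of_mem _ hi]
  refine Finset.sum_eq_zero fun c _ => ?_
  obtain ⟨ξ, η⟩ := c
  rw [Finset.sum_filter]
  have := congrArg (g (zOf ξ η) (δOf ξ η) * ·) (hbal t ξ η)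
  simp only [mul_zero, Finset.mul_sum] at this
  refine (Finset.sum_congr rfl fun i _ => ?_).trans this
  simp only [Prod.mk.injEq]
  by_cases h : upTo t (x i) = ξ ∧ past t (y i) = η
  · rw [if_pos h, if_pos h]
    obtain ⟨rfl, rfl⟩ := h
    change p i * (g (zOf (upTo t (x i)) (past t (y i))) (δOf (upTo t (x i)) (past t (y i))) *
      δ t (upTo t (x i)) (past t (y i)) (y i t)) = _
    ring
  · rw [if_neg h, if_neg h]
    ring

/-- It suffices to control the statistic along finite martingale difference processes. -/
lemma exists_achieves_of_finiteMartingaleDifference.{u} {X : Type u} {𝒯 : Type*} [AddCommGroup 𝒯]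
    {n : ℕ} {Y : Set ℝ} (hY : Y.Nonempty) (hYc : IsCompact Y)
    {L : ℝ≥0} {ℓ : ℝ → ℝ → ℝ} (hℓ : IsAdmissibleLoss Y L ℓ) {φ : (Fin n → X × Y) → ℝ}
    {T : X × Y → ℝ → 𝒯} {V : 𝒯 → ℝ} (hTV : IsSufficientStatisticPair L ℓ φ T V)
    (hmart : ∀ {ι : Type u} [Fintype ι] {p : ι → ℝ} {z : ι → Fin n → X × Y} {δ : ι → Fin n → ℝ},
      IsFiniteMartingaleDifference p z δ → (∀ i t, δ i t ∈ Icc (-(L : ℝ)) L) →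
        ∑ i, p i * V (∑ t, T (z i t) (δ i t)) ≤ 0) :
    ∃ q : PredictionStrategy n X Y, q.Achieves ℓ φ := by
  have : CompactSpace Y := isCompact_iff_compactSpace.1 hYc
  refine PredictionStrategy.exists_achieves hY
    (fun y => (hℓ.lipschitz y y.2).continuousOn.domRestrict) φ fun s p hp hp1 => ?_
  exact exists_response_nonpos hY hℓ hTV hp hp1 (fun i => i.1.1) (fun i => i.1.2)
    fun z δ h hδ => hmart h hδ

theorem mainTheorem9 {X : Type*} [MeasurableSpace X] {𝒯 : Type*} [AddCommGroup 𝒯] [Module ℝ 𝒯]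
    (n : ℕ) (Y : Set ℝ) (hYne : Y.Nonempty) (hYc : IsCompact Y)
    (L : ℝ≥0) (ℓ : ℝ → ℝ → ℝ) (hℓ : IsAdmissibleLoss Y L ℓ)
    (φ : (Fin n → X × Y) → ℝ) (hφ : ∃ C : ℝ, ∀ h, |φ h| ≤ C)
    (T : X × Y → ℝ → 𝒯) (V : 𝒯 → ℝ) (hTV : IsSufficientStatisticPair L ℓ φ T V) :
    ((∀ (z : PredictableSequence n (X × Y)) (μ : Measure (Fin n → ℝ)),
        IsMartingaleDifferenceLaw L μ → Integrable (statisticValue T V z) μ →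
          ∫ δ, statisticValue T V z δ ∂μ ≤ 0) →
      ∃ q : PredictionStrategy n X Y, q.Achieves ℓ φ) ∧
    ((∀ (z : X × Y) (τ : 𝒯), ConvexOn ℝ (Icc (-(L : ℝ)) L) (fun α => V (τ + T z α))) →
      (∀ z : PredictableSequence n (X × Y),
        ∫ ε, statisticValue T V z (fun t => ε t * L) ∂(Measure.pi fun _ : Fin n => rademacher)
          ≤ 0) →
      ∃ q : PredictionStrategy n X Y, q.Achieves ℓ φ) := by
  refine ⟨fun hV => ?_, fun hconv hV => ?_⟩
  · exact exists_achieves_of_finiteMartingaleDifference hYne hYc hℓ hTV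
      fun h hδ => h.sum_statistic_nonpos hδ hV
  · refine exists_achieves_of_finiteMartingaleDifference hYne hYc hℓ hTV
      fun {ι} _ {p z δ} h hδ => ?_
    have hrad : IsProbabilityMeasure rademacher :=
      ⟨by simp [rademacher, ENNReal.inv_two_add_inv_two]⟩
    -- For `L = 0` no rescaling is possible, but then `δ = 0` and the Rademacher integrand is
    -- constant.
    rcases eq_or_lt_of_le (show (0 : ℝ) ≤ L from L.2) with hL | hL
    · have hδ0 : δ = fun _ _ => 0 := by
        funext i t
        simpa [← hL] using hδ i t
      obtain ⟨p', z', h', -, hle⟩ :=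
        h.exists_predictableSequence_le fun ζ η => V (∑ t, T (ζ t) (η t))
      refine hle.trans ?_
      have hz := hV z'
      simp only [← hL, mul_zero, integral_const, probReal_univ, one_smul] at hz
      subst hδ0
      rw [← Finset.sum_mul, h'.sum_eq_one, one_mul]
      exact hz
    have hscale : ∀ i t, δ i t / L * L = δ i t := fun i t => div_mul_cancel₀ _ hL.ne'
    have h' : IsFiniteMartingaleDifference p z fun i t => δ i t / L := by
      refine ⟨h.nonneg, h.sum_eq_one, fun t g => ?_⟩
      have := congrArg (· * (L : ℝ)⁻¹) (h.orthogonal t fun a e => g a fun s => e s / L)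
      simp only [zero_mul, Finset.sum_mul] at this
      refine (Finset.sum_congr rfl fun i _ => ?_).trans this
      change p i * (g (upTo t (z i)) (fun s => past t (δ i) s / L) * (δ i t / L)) = _
      ring
    have key := sum_nonpos_of_separately_convex
      (W := fun (ζ : Fin n → X × Y) η => V (∑ t, T (ζ t) (η t * L))) ?_ ?_ h' ?_
    · simpa only [hscale] using key
    · intro ζ η t
      have h1 : ∀ α : ℝ, ∑ s, T (ζ s) (Function.update η t α s * L) =
          (∑ s ∈ Finset.univ.erase t, T (ζ s) (η s * L)) + T (ζ t) (α * L) := by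
        intro α
        rw [← Finset.sum_erase_add _ _ (Finset.mem_univ t), Function.update_self]
        congr 1
        exact Finset.sum_congr rfl fun s hs => by
          rw [Function.update_of_ne (Finset.ne_of_mem_erase hs)]
      simp only [h1]
      have hc := (hconv (ζ t) (∑ s ∈ Finset.univ.erase t, T (ζ s) (η s * L))).comp_linearMap
        (LinearMap.mulRight ℝ (L : ℝ))
      refine hc.subset (fun α hα => ?_) (convex_Icc _ _)
      simp only [mem_preimage, LinearMap.mulRight_apply]
      exact ⟨by nlinarith [hα.1], by nlinarith [hα.2]⟩
    · intro ι _ p z ε h hε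
      -- Conditioning comes only after the passage to signs: `z` must be predictable from the signs,
      -- not from the original `δ`.
      obtain ⟨p', z', h', -, hle⟩ :=
        h.exists_predictableSequence_le fun ζ η => V (∑ t, T (ζ t) (η t * L))
      refine hle.trans ?_
      rw [h'.sum_eq_integral_rademacher hε fun η =>
        V (∑ t, T (z'.toFun t (past t η)) (η t * L))]
      -- The hypothesis feeds `ε t * L` to the predictable sequence, hence the division by `L`.
      have hz := hV ⟨fun t e => z'.toFun t fun s => e s / L,
        fun t => (z'.measurable t).comp (by fun_prop)⟩
      refine (integral_congr_ae (ae_of_all _ fun ε => ?_)).trans_le hz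
      have : ∀ t : Fin n, (fun s => past t (fun r => ε r * (L : ℝ)) s / L) = past t ε :=
        fun t => funext fun s => mul_div_cancel_right₀ _ hL.ne'
      simp only [statisticValue, this]
    · intro i t
      have := hδ i t
      exact ⟨by rw [le_div_iff₀ hL]; linarith [this.1], by rw [div_le_iff₀ hL]; linarith [this.2]⟩

end
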